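/- Let $\{X_n\}_{n\in\mathbb{Z}}$ be a zero-mean stationary real Gaussian process and let $\{Z_n\}_{n\in\mathbb{Z}}$ be i.i.d. uniform on $(-1,0]$, independent of $\{X_n\}$. All logarithms are to base $2$. For $D>0$ let $\alpha>0$ be given by $D=\frac{1}{12\alpha^2}$, let $V_n=\alpha X_n+Z_n$, and let $$\sigma_p^2=\sigma_p^2(D)=\min_{h_1,\dots,h_p\in\mathbb{R}}\mathbb{E}\Big(V_n-\Big[\sum_{i=1}^p h_i\big(V_{n-i}+\tfrac12\big)-\tfrac12\Big]\Big)^2$$ be the error variance of the optimal $p$-tap linear predictor of $V_n$ from $V_{n-1},\dots,V_{n-p}$. Let $h(X_n\mid X_{n-1},X_{n-2},\dots)$ be the conditional differential entropy of $X_n$ given its infinite past, that is, the average over the past of the differential entropy of the conditional distribution of $X_n$ (equal to $-\infty$ for a distribution without a density), and let $$R_{\mathrm{SLB}}(D)=h(X_n\mid X_{n-1},X_{n-2},\dots)-\tfrac12\log(2\pi e D)$$ be the Shannon lower bound. If $h(X_n\mid X_{n-1},X_{n-2},\dots)>-\infty$, then for every $D>0$ the limit $\lim_{p\to\infty}\frac12\log(12\sigma_p^2)$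 exists and is finite, and $$\lim_{D\to0^+}\Big[\lim_{p\to\infty}\tfrac12\log\big(12\sigma_p^2\big)-R_{\mathrm{SLB}}(D)\Big]=0 .$$ -/

import Mathlib

open MeasureTheory ProbabilityTheory Filter Topology

noncomputable section

/-- The integral of an extended-real-valued function: the integral of the positive part minus the
integral of the negative part (with the value `⊥` in the indeterminate case `⊤ - ⊤`). -/
def erealIntegral {β : Type*} [MeasurableSpace β] (μ : Measure β) (f : β → EReal) : EReal :=
  ((∫⁻ x, (f x).toENNReal ∂μ : ENNReal) : EReal) -
    ((∫⁻ x, (-f x).toENNReal ∂μ : ENNReal) : EReal)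

open Classical in
/-- The differential entropy, in bits, of a distribution `ν` on the real line:
`-∫ f log₂ f` when `ν` has the density `f` with respect to Lebesgue measure, and `-∞` when `ν` is
not absolutely continuous. -/
def differentialEntropy (ν : Measure ℝ) : EReal :=
  if ν ≪ volume then
    erealIntegral volume fun x ↦
      ((-((ν.rnDeriv volume x).toReal * Real.logb 2 (ν.rnDeriv volume x).toReal) : ℝ) : EReal)
  else ⊥

/-- The conditional differential entropy `h(A | B)`, in bits: the average, over the law of `B`,
of the differential entropy of the conditional distribution of `A` given `B = b`. The random
variable `B` may take values in any measurable space. -/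
def condDifferentialEntropy {Ω β : Type*} [MeasurableSpace Ω] [MeasurableSpace β]
    (A : Ω → ℝ) (B : Ω → β) (P : Measure Ω) [IsFiniteMeasure P] : EReal :=
  erealIntegral (P.map B) fun b ↦ differentialEntropy (condDistrib A B P b)

/-- The entropy rate `h(X_n | X_{n-1}, X_{n-2}, …)`: the conditional differential entropy of
`X_n` given the whole infinite past. -/
def entropyRate {Ω : Type*} [MeasurableSpace Ω] (X : ℤ → Ω → ℝ) (P : Measure Ω)
    [IsFiniteMeasure P] (n : ℤ) : EReal :=
  condDifferentialEntropy (X n) (fun ω (i : ℕ) ↦ X (n - 1 - (i : ℤ)) ω) P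

/-- The Shannon lower bound
`R_SLB(D) = h(X_n | X_{n-1}, …) - ½ log₂ (2 π e D)`. -/
def shannonLowerBound {Ω : Type*} [MeasurableSpace Ω] (X : ℤ → Ω → ℝ) (P : Measure Ω)
    [IsFiniteMeasure P] (n : ℤ) (D : ℝ) : EReal :=
  entropyRate X P n - ((1 / 2 * Real.logb 2 (2 * Real.pi * Real.exp 1 * D) : ℝ) : EReal)

/-- (Strict) stationarity: every time shift of the process has the same law as the process. -/
def IsStationaryProcess {Ω : Type*} [MeasurableSpace Ω] (X : ℤ → Ω → ℝ) (P : Measure Ω) : Prop :=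
  ∀ k : ℤ, IdentDistrib (fun ω (n : ℤ) ↦ X (n + k) ω) (fun ω (n : ℤ) ↦ X n ω) P P

/-- The resolution parameter `α > 0` for which `D = 1 / (12 α²)`. -/
def resolution (D : ℝ) : ℝ := 1 / √(12 * D)

/-- The unfolded output `V_n = α X_n + Z_n` of the modulo converter. -/
def unfoldedOutput {Ω : Type*} (α : ℝ) (X Z : ℤ → Ω → ℝ) (n : ℤ) (ω : Ω) : ℝ :=
  α * X n ω + Z n ω

/-- The `p`-tap linear predictor `∑_{i=1}^p h_i (V_{n-i} + 1/2) - 1/2` of `V_n`; the tap `h_i` is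
stored at index `i - 1`. -/
def linearPredictor {Ω : Type*} {p : ℕ} (h : Fin p → ℝ) (V : ℤ → Ω → ℝ) (n : ℤ) (ω : Ω) : ℝ :=
  ∑ i : Fin p, h i * (V (n - ((i : ℕ) + 1 : ℤ)) ω + 1 / 2) - 1 / 2

/-- The error variance `σ_p²` of the optimal `p`-tap linear predictor of `V_n`: the least mean
square error `E (V_n - ∑_{i=1}^p h_i (V_{n-i} + 1/2) + 1/2)²` over all taps `h`. -/
def predictionErrorVariance {Ω : Type*} [MeasurableSpace Ω] (V : ℤ → Ω → ℝ) (P : Measure Ω)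
    (n : ℤ) (p : ℕ) : ℝ :=
  ⨅ h : Fin p → ℝ, ∫ ω, (V n ω - linearPredictor h V n ω) ^ 2 ∂P

end

/-! Let `q p h` be the mean square error of predicting `X n` from its own past with `p` taps `h`.
The centered dither is white with variance 1/12 and independent of `X`, so the error for `V` is α²
`q p h` + (1 + ∑ h²)/12. Since α² = 1/(12D), 12σ_p² is the infimum over `h` of `q p h` / D + 1 + ∑
h²: least squares with a penalty on the taps. It decreases in `p` (pad with zero taps) and is at
least 1, so it tends to some S(D) ≥ 1.

Projecting `X n` in L² on the closed span of its past gives `X n` = m(past) + N, where N is a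
Gaussian independent of the past whose variance `v` is the infimum of all `q p h`
(`exists_innovation_decomposition`). The conditional law is Gaussian with variance `v`, so the
entropy rate is ½ log(2πe v), or -∞ when `v = 0`; finite entropy thus means `v > 0`. The claim
reduces to D · S(D) → `v`: the penalty D(1 + ∑ h²) of any fixed near-optimal predictor vanishes with
D (`tendsto_mul_iInf_regularized`). -/

/-! ### Extended-real integrals and Gaussian entropy. -/

theorem erealIntegral_congr_ae {β : Type*} [MeasurableSpace β] {μ : Measure β} {f g : β → EReal}
    (h : f =ᵐ[μ] g) : erealIntegral μ f = erealIntegral μ g := by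
  unfold erealIntegral
  congr 2
  · exact lintegral_congr_ae (h.mono fun x hx ↦ by simp only [hx])
  · exact lintegral_congr_ae (h.mono fun x hx ↦ by simp only [hx])

theorem erealIntegral_coe {β : Type*} [MeasurableSpace β] {μ : Measure β} {f : β → ℝ}
    (hf : Integrable f μ) :
    erealIntegral μ (fun x ↦ (f x : EReal)) = ((∫ x, f x ∂μ : ℝ) : EReal) := by
  have h1 : ∫⁻ x, ENNReal.ofReal (f x) ∂μ ≠ ⊤ := hf.lintegral_lt_top.ne
  have h2 : ∫⁻ x, ENNReal.ofReal (-f x) ∂μ ≠ ⊤ := hf.neg.lintegral_lt_top.ne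
  have h3 (x : β) : (-(f x : EReal)).toENNReal = ENNReal.ofReal (-f x) := by
    rw [← EReal.coe_neg, EReal.toENNReal_of_ne_top (EReal.coe_ne_top _), EReal.toReal_coe]
  have h4 (x : β) : (f x : EReal).toENNReal = ENNReal.ofReal (f x) := by
    rw [EReal.toENNReal_of_ne_top (EReal.coe_ne_top _), EReal.toReal_coe]
  simp only [erealIntegral, h3, h4]
  have h5 {a : ENNReal} (ha : a ≠ ⊤) : (a : EReal) = (a.toReal : EReal) := by
    lift a to NNReal using ha
    rfl
  rw [integral_eq_lintegral_pos_part_sub_lintegral_neg_part hf, EReal.coe_sub, h5 h1, h5 h2]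

/-- Averages a conditional entropy that does not depend on the past, including the degenerate value
`⊥`. -/
theorem erealIntegral_const {β : Type*} [MeasurableSpace β] (μ : Measure β)
    [IsProbabilityMeasure μ] (c : EReal) : erealIntegral μ (fun _ ↦ c) = c := by
  induction c using EReal.rec with
  | bot => simp [erealIntegral]
  | top => simp [erealIntegral]
  | coe r =>
    simpa using erealIntegral_coe (μ := μ) (integrable_const r)

theorem differentialEntropy_dirac (m : ℝ) : differentialEntropy (Measure.dirac m) = ⊥ := by
  rw [differentialEntropy, if_neg]
  intro h
  have := h (Real.volume_singleton (a := m))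
  simp at this

theorem log_gaussianPDFReal (m : ℝ) {v : NNReal} (hv : v ≠ 0) (x : ℝ) :
    Real.log (gaussianPDFReal m v x) =
      -(1 / 2 * Real.log (2 * Real.pi * v) + (x - m) ^ 2 / (2 * v)) := by
  have hv' : (0 : ℝ) < v := by positivity
  rw [gaussianPDFReal, Real.log_mul (by positivity) (by positivity), Real.log_inv, Real.log_exp,
    Real.log_sqrt (by positivity)]
  ring

theorem differentialEntropy_gaussianReal (m : ℝ) {v : NNReal} (hv : v ≠ 0) :
    differentialEntropy (gaussianReal m v) =
      ((1 / 2 * Real.logb 2 (2 * Real.pi * Real.exp 1 * v) : ℝ) : EReal) := by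
  have hv' : (0 : ℝ) < v := by positivity
  rw [differentialEntropy, if_pos (gaussianReal_absolutelyContinuous m hv)]
  -- `q` is minus the base-2 logarithm of the density, so the entropy is the Gaussian mean of `q`.
  set q : ℝ → ℝ := fun x ↦
    (1 / 2 * Real.log (2 * Real.pi * v) + (2 * (v : ℝ))⁻¹ * (x - m) ^ 2) * (Real.log 2)⁻¹ with hq
  have hsq : Integrable (fun x : ℝ ↦ (x - m) ^ 2) (gaussianReal m v) :=
    ((memLp_id_gaussianReal 2).sub (memLp_const m)).integrable_sq
  have hint : Integrable q (gaussianReal m v) :=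
    ((integrable_const _).add (hsq.const_mul _)).mul_const _
  have hvar : ∫ x, (x - m) ^ 2 ∂(gaussianReal m v) = v := by
    have := variance_id_gaussianReal (μ := m) (v := v)
    rw [variance_eq_integral aemeasurable_id] at this
    simpa [integral_id_gaussianReal] using this
  have hval : ∫ x, q x ∂(gaussianReal m v) =
      1 / 2 * Real.logb 2 (2 * Real.pi * Real.exp 1 * v) := by
    rw [hq, integral_mul_const, integral_add (integrable_const _) (hsq.const_mul _),
      integral_const_mul, integral_const_mul, hvar, integral_const, probReal_univ, one_smul, Real.logb,
      show 2 * Real.pi * Real.exp 1 * v = 2 * Real.pi * v * Real.exp 1 by ring,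
      Real.log_mul (x := 2 * Real.pi * v) (by positivity) (by positivity), Real.log_exp]
    field_simp
  have hpdf : (fun x ↦ ((-(((gaussianReal m v).rnDeriv volume x).toReal *
      Real.logb 2 ((gaussianReal m v).rnDeriv volume x).toReal) : ℝ) : EReal)) =ᵐ[volume]
      fun x ↦ ((gaussianPDFReal m v x * q x : ℝ) : EReal) := by
    filter_upwards [rnDeriv_gaussianReal m v] with x hx
    rw [hx, toReal_gaussianPDF, Real.logb, log_gaussianPDFReal m hv]
    congr 1
    simp only [hq]
    ring
  have hint' : Integrable (fun x ↦ gaussianPDFReal m v x * q x) := by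
    rw [gaussianReal_of_var_ne_zero m hv,
      integrable_withDensity_iff_integrable_smul' (measurable_gaussianPDF m v)
        (ae_of_all _ fun _ ↦ gaussianPDF_lt_top)] at hint
    simpa using hint
  rw [erealIntegral_congr_ae hpdf, erealIntegral_coe hint', ← hval,
    integral_gaussianReal_eq_integral_smul hv]
  simp

/-! ### Almost sure limits of Gaussian families. -/

/-- An almost sure limit of centered real Gaussian random variables is a centered Gaussian. -/
theorem exists_map_eq_gaussianReal_of_tendsto_ae {Ω : Type*} [MeasurableSpace Ω] {P : Measure Ω}
    [IsProbabilityMeasure P] {U : ℕ → Ω → ℝ} {U' : Ω → ℝ} {v : ℕ → NNReal}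
    (hUm : ∀ k, AEMeasurable (U k) P) (hU : ∀ k, P.map (U k) = gaussianReal 0 (v k))
    (hlim : ∀ᵐ ω ∂P, Tendsto (fun k ↦ U k ω) atTop (𝓝 (U' ω))) :
    ∃ w : NNReal, P.map U' = gaussianReal 0 w := by
  have hUm' : AEMeasurable U' P := aemeasurable_of_tendsto_metrizable_ae atTop hUm hlim
  have : IsProbabilityMeasure (P.map U') := Measure.isProbabilityMeasure_map hUm'
  have hchar {Y : Ω → ℝ} (hY : AEMeasurable Y P) (t : ℝ) :
      charFun (P.map Y) t = ∫ ω, Complex.exp (t * Y ω * Complex.I) ∂P := by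
    rw [charFun_apply_real, integral_map hY (by fun_prop)]
  have hconv (t : ℝ) : Tendsto (fun k ↦ Complex.exp (-(v k * t ^ 2 / 2)))
      atTop (𝓝 (charFun (P.map U') t)) := by
    have h1 (k : ℕ) : Complex.exp (-(v k * t ^ 2 / 2)) =
        ∫ ω, Complex.exp (t * U k ω * Complex.I) ∂P := by
      rw [← hchar (hUm k), hU, charFun_gaussianReal]
      simp
    simp only [h1, hchar hUm']
    refine tendsto_integral_of_dominated_convergence (fun _ ↦ 1)
      (fun k ↦ AEMeasurable.aestronglyMeasurable ?_) (integrable_const _) (fun k ↦ ?_) ?_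
    · have := hUm k
      fun_prop
    · refine ae_of_all _ fun ω ↦ ?_
      rw [← Complex.ofReal_mul, Complex.norm_exp_ofReal_mul_I]
    · filter_upwards [hlim] with ω hω
      have hc : Continuous fun x : ℝ ↦ Complex.exp (t * x * Complex.I) := by fun_prop
      exact (hc.tendsto _).comp hω
  have hnorm (t : ℝ) : Tendsto (fun k ↦ Real.exp (-(v k * t ^ 2 / 2)))
      atTop (𝓝 ‖charFun (P.map U') t‖) := by
    refine (hconv t).norm.congr fun k ↦ ?_
    rw [Complex.norm_exp]
    congr 1
    norm_cast
  -- The limit characteristic function is 1 at 0 and continuous, hence nonzero at some `t ≠ 0`;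
  -- taking logarithms there makes the variances converge.
  obtain ⟨t, ht, ht0⟩ : ∃ t : ℝ, 0 < ‖charFun (P.map U') t‖ ∧ t ≠ 0 := by
    have hc : ContinuousAt (fun t : ℝ ↦ ‖charFun (P.map U') t‖) 0 :=
      (continuous_charFun.norm).continuousAt
    have h0 : ∀ᶠ t in 𝓝 (0 : ℝ), 0 < ‖charFun (P.map U') t‖ := by
      refine hc.eventually (lt_mem_nhds ?_)
      simp
    obtain ⟨t, ht⟩ := ((h0.filter_mono nhdsWithin_le_nhds).and
      (self_mem_nhdsWithin : {(0 : ℝ)}ᶜ ∈ 𝓝[≠] 0)).exists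
    exact ⟨t, ht.1, ht.2⟩
  have hv : ∃ w : NNReal, Tendsto v atTop (𝓝 w) := by
    have h1 : Tendsto (fun k ↦ (v k : ℝ)) atTop
        (𝓝 (-(Real.log ‖charFun (P.map U') t‖ * (2 / t ^ 2)))) := by
      refine (((hnorm t).log ht.ne').mul_const (2 / t ^ 2)).neg.congr fun k ↦ ?_
      rw [Real.log_exp]
      field_simp
    have h2 := ge_of_tendsto' h1 fun k ↦ (v k).coe_nonneg
    exact ⟨⟨_, h2⟩, NNReal.tendsto_coe.mp h1⟩
  obtain ⟨w, hw⟩ := hv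
  refine ⟨w, Measure.ext_of_charFun (funext fun s ↦ tendsto_nhds_unique (hconv s) ?_)⟩
  rw [charFun_gaussianReal]
  have hc : Continuous fun x : NNReal ↦ Complex.exp (-((x : ℝ) * s ^ 2 / 2)) := by fun_prop
  simpa [Function.comp_def] using (hc.tendsto w).comp hw

/-- An almost sure limit of centered real Gaussian processes is a Gaussian process. -/
theorem isGaussianProcess_of_tendsto_ae {Ω T : Type*} [MeasurableSpace Ω] {P : Measure Ω}
    [IsProbabilityMeasure P] {W : ℕ → T → Ω → ℝ} {W' : T → Ω → ℝ}
    (hW : ∀ k, IsGaussianProcess (W k) P) (hmean : ∀ k t, ∫ ω, W k t ω ∂P = 0)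
    (hlim : ∀ t, ∀ᵐ ω ∂P, Tendsto (fun k ↦ W k t ω) atTop (𝓝 (W' t ω))) :
    IsGaussianProcess W' P where
  hasGaussianLaw I := by
    have hWm' (t : T) : AEMeasurable (W' t) P :=
      aemeasurable_of_tendsto_metrizable_ae atTop (fun k ↦ (hW k).aemeasurable t) (hlim t)
    have hR : AEMeasurable (fun ω ↦ I.restrict (W' · ω)) P :=
      aemeasurable_pi_lambda _ fun i ↦ hWm' i
    -- Gaussianity is tested on one linear functional at a time, which reduces to the scalar limit.
    refine ⟨⟨fun L ↦ ?_⟩⟩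
    have hL : Measurable L := L.continuous.measurable
    have hgauss (k : ℕ) : HasGaussianLaw (fun ω ↦ L (I.restrict (W k · ω))) P :=
      ((hW k).hasGaussianLaw I).map L
    have hzero (k : ℕ) : ∫ ω, L (I.restrict (W k · ω)) ∂P = 0 := by
      have hi : Integrable (fun ω ↦ I.restrict (W k · ω)) P := ((hW k).hasGaussianLaw I).integrable
      rw [L.integral_comp_comm hi]
      convert map_zero L
      ext i
      rw [eval_integral fun j ↦ hi.eval j]
      exact hmean k i
    obtain ⟨w, hw⟩ := exists_map_eq_gaussianReal_of_tendsto_ae (P := P)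
      (U := fun k ω ↦ L (I.restrict (W k · ω))) (U' := fun ω ↦ L (I.restrict (W' · ω)))
      (v := fun k ↦ Var[fun ω ↦ L (I.restrict (W k · ω)); P].toNNReal)
      (fun k ↦ (hgauss k).aemeasurable) (fun k ↦ by rw [(hgauss k).map_eq_gaussianReal, hzero])
      (by
        have : ∀ᵐ ω ∂P, ∀ i : I, Tendsto (fun k ↦ W k i ω) atTop (𝓝 (W' i ω)) :=
          ae_all_iff.mpr fun i ↦ hlim i
        filter_upwards [this] with ω hω
        exact (L.continuous.tendsto _).comp (tendsto_pi_nhds.mpr hω))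
    have hmap : (P.map fun ω ↦ I.restrict (W' · ω)).map L = gaussianReal 0 w := by
      rw [AEMeasurable.map_map_of_aemeasurable hL.aemeasurable hR]
      exact hw
    have hm : ∫ x, L x ∂(P.map fun ω ↦ I.restrict (W' · ω)) = 0 := by
      rw [← integral_map (f := fun x ↦ x) hL.aemeasurable (by fun_prop), hmap,
        integral_id_gaussianReal]
    have hv : Var[L; P.map fun ω ↦ I.restrict (W' · ω)] = w := by
      rw [← variance_id_map hL.aemeasurable, hmap, variance_id_gaussianReal]
    rw [hm, hv, hmap, Real.toNNReal_coe]

/-! ### Conditional entropy of signal plus independent noise. -/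

/-- If `A = m(B) + N` with `N` a centered Gaussian independent of `B`, the conditional law of `A`
given `B = b` is the Gaussian with mean `m b` and the variance of `N`. -/
theorem condDistrib_ae_eq_gaussianReal {Ω β : Type*} [MeasurableSpace Ω] [MeasurableSpace β]
    {P : Measure Ω} [IsProbabilityMeasure P] {A N : Ω → ℝ} {B : Ω → β} {m : β → ℝ} {v : NNReal}
    (hB : AEMeasurable B P) (hN : AEMeasurable N P) (hm : Measurable m)
    (hA : A = fun ω ↦ m (B ω) + N ω) (hind : IndepFun B N P)
    (hlaw : P.map N = gaussianReal 0 v) :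
    ∀ᵐ b ∂(P.map B), condDistrib A B P b = gaussianReal (m b) v := by
  let κ : Kernel β ℝ := ⟨fun b ↦ gaussianReal (m b) v,
    measurable_gaussianReal.comp (hm.prodMk measurable_const)⟩
  have : IsMarkovKernel κ := ⟨fun b ↦ by
    change IsProbabilityMeasure (gaussianReal (m b) v)
    infer_instance⟩
  have hAm : AEMeasurable A P := by
    rw [hA]
    exact (hm.comp_aemeasurable hB).add hN
  -- By uniqueness of disintegration it suffices to identify the joint law of `(B, A)`.
  refine condDistrib_ae_eq_of_measure_eq_compProd (κ := κ) B hAm ?_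
  have hprob : IsProbabilityMeasure (P.map B) := Measure.isProbabilityMeasure_map hB
  have hg : Measurable fun z : β × ℝ ↦ (z.1, m z.1 + z.2) := by fun_prop
  have hjoint : P.map (fun ω ↦ (B ω, A ω)) =
      ((P.map B).prod (gaussianReal 0 v)).map fun z ↦ (z.1, m z.1 + z.2) := by
    rw [← hlaw, ← (indepFun_iff_map_prod_eq_prod_map_map hB hN).mp hind,
      AEMeasurable.map_map_of_aemeasurable hg.aemeasurable (hB.prodMk hN), hA]
    rfl
  ext s hs
  rw [hjoint, Measure.map_apply hg hs, Measure.prod_apply (hg hs), Measure.compProd_apply hs]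
  refine lintegral_congr fun b ↦ ?_
  change _ = gaussianReal (m b) v (Prod.mk b ⁻¹' s)
  rw [← zero_add (m b), ← gaussianReal_map_const_add (m b),
    Measure.map_apply (by fun_prop) (hs.preimage (by fun_prop))]
  rfl

/-- The conditional differential entropy of a Gaussian signal in independent Gaussian noise is the
differential entropy of the noise. -/
theorem condDifferentialEntropy_eq {Ω β : Type*} [MeasurableSpace Ω] [MeasurableSpace β]
    {P : Measure Ω} [IsProbabilityMeasure P] {A N : Ω → ℝ} {B : Ω → β} {m : β → ℝ} {v : NNReal}
    (hB : AEMeasurable B P) (hN : AEMeasurable N P) (hm : Measurable m)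
    (hA : A = fun ω ↦ m (B ω) + N ω) (hind : IndepFun B N P)
    (hlaw : P.map N = gaussianReal 0 v) :
    condDifferentialEntropy A B P =
      if v = 0 then ⊥ else ((1 / 2 * Real.logb 2 (2 * Real.pi * Real.exp 1 * v) : ℝ) : EReal) := by
  have : IsProbabilityMeasure (P.map B) := Measure.isProbabilityMeasure_map hB
  rw [condDifferentialEntropy, ← erealIntegral_const (P.map B) (ite _ _ _)]
  refine erealIntegral_congr_ae ?_
  filter_upwards [condDistrib_ae_eq_gaussianReal hB hN hm hA hind hlaw] with b hb
  rw [hb]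
  split_ifs with hv
  · rw [hv, gaussianReal_zero_var, differentialEntropy_dirac]
  · exact differentialEntropy_gaussianReal (m b) hv

/-! ### Innovation decomposition in L². -/

theorem norm_sq_eq_integral_of_ae_eq {Ω : Type*} [MeasurableSpace Ω] {P : Measure Ω}
    {F : Lp ℝ 2 P} {f : Ω → ℝ} (h : F =ᵐ[P] f) : ‖F‖ ^ 2 = ∫ ω, f ω ^ 2 ∂P := by
  rw [← real_inner_self_eq_norm_sq, L2.inner_def]
  refine integral_congr_ae ?_
  filter_upwards [h] with ω hω
  simp [hω, sq]

theorem coeFn_sum_smul_toLp {Ω ι : Type*} [MeasurableSpace Ω] {P : Measure Ω} {Y : ι → Ω → ℝ}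
    (hY : ∀ i, MemLp (Y i) 2 P) (s : Finset ι) (c : ι → ℝ) :
    ((∑ i ∈ s, c i • (hY i).toLp (Y i) : Lp ℝ 2 P) : Ω → ℝ) =ᵐ[P]
      fun ω ↦ ∑ i ∈ s, c i * Y i ω := by
  classical
  induction s using Finset.induction_on with
  | empty =>
    filter_upwards [Lp.coeFn_zero ℝ 2 P] with ω h
    simpa using h
  | insert i s hi ih =>
    rw [Finset.sum_insert hi]
    filter_upwards [ih, Lp.coeFn_add (c i • (hY i).toLp (Y i)) (∑ i ∈ s, c i • (hY i).toLp (Y i)),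
      Lp.coeFn_smul (c i) ((hY i).toLp (Y i)), (hY i).coeFn_toLp] with ω h1 h2 h3 h4
    rw [h2, Finset.sum_insert hi, Pi.add_apply, h1, h3, Pi.smul_apply, h4, smul_eq_mul]

/-- The residual of finitely many members of a Gaussian process, together with the process, is a
Gaussian process. -/
theorem isGaussianProcess_residual {Ω ι : Type*} [MeasurableSpace Ω] {P : Measure Ω}
    {A : Ω → ℝ} {Y : ι → Ω → ℝ}
    (hG : IsGaussianProcess (Sum.elim (fun _ : Unit ↦ A) Y) P) (s : Finset ι) (c : ι → ℝ) :
    IsGaussianProcess (Sum.elim (fun (_ : Unit) ω ↦ A ω - ∑ i ∈ s, c i * Y i ω) Y) P := by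
  classical
  refine hG.of_isGaussianProcess ?_
  rintro (_ | j)
  · refine ⟨({()} : Finset Unit).disjSum s, ContinuousLinearMap.proj ⟨Sum.inl (), by simp⟩ -
      ∑ i : s, c i • ContinuousLinearMap.proj ⟨Sum.inr i, by simp⟩, fun ω ↦ ?_⟩
    simpa using (Finset.sum_attach s (fun i ↦ c i * Y i ω)).symm
  · exact ⟨{Sum.inr j}, ContinuousLinearMap.proj ⟨Sum.inr j, by simp⟩, fun ω ↦ by simp⟩

/-- The innovation decomposition of a centered Gaussian variable `A` with respect to a jointly
Gaussian centered sequence `Y`: a measurable function of `Y` plus an independent centered Gaussian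
whose variance is the infimum of the error variances of the finite linear predictors. -/
theorem exists_innovation_decomposition {Ω : Type*} [MeasurableSpace Ω] {P : Measure Ω}
    [IsProbabilityMeasure P] {A : Ω → ℝ} {Y : ℕ → Ω → ℝ}
    (hG : IsGaussianProcess (Sum.elim (fun _ : Unit ↦ A) Y) P)
    (hA0 : ∫ ω, A ω ∂P = 0) (hY0 : ∀ i, ∫ ω, Y i ω ∂P = 0) :
    ∃ (m : (ℕ → ℝ) → ℝ) (N : Ω → ℝ) (v : NNReal), Measurable m ∧
      (A = fun ω ↦ m (fun i ↦ Y i ω) + N ω) ∧ AEMeasurable N P ∧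
      IndepFun (fun ω i ↦ Y i ω) N P ∧ P.map N = gaussianReal 0 v ∧
      (∀ (p : ℕ) (h : Fin p → ℝ), (v : ℝ) ≤ ∫ ω, (A ω - ∑ i, h i * Y i ω) ^ 2 ∂P) ∧
      ∀ ε > 0, ∃ (p : ℕ) (h : Fin p → ℝ), ∫ ω, (A ω - ∑ i, h i * Y i ω) ^ 2 ∂P < v + ε := by
  have hA : MemLp A 2 P := (hG.hasGaussianLaw_eval (Sum.inl ())).memLp_two
  have hY (i : ℕ) : MemLp (Y i) 2 P := (hG.hasGaussianLaw_eval (Sum.inr i)).memLp_two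
  have hYm (i : ℕ) : AEMeasurable (Y i) P := (hY i).aestronglyMeasurable.aemeasurable
  have hBm : AEMeasurable (fun ω i ↦ Y i ω) P := aemeasurable_pi_lambda _ hYm
  set a : Lp ℝ 2 P := hA.toLp A with ha
  set y : ℕ → Lp ℝ 2 P := fun i ↦ (hY i).toLp (Y i) with hy
  set S : Submodule ℝ (Lp ℝ 2 P) := Submodule.span ℝ (Set.range y) with hS
  set K := S.topologicalClosure with hK
  have : CompleteSpace K := S.isClosed_topologicalClosure.completeSpace_coe
  set M : Lp ℝ 2 P := K.starProjection a with hM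
  have hMK : M ∈ closure (S : Set (Lp ℝ 2 P)) := by
    rw [← Submodule.topologicalClosure_coe]
    exact K.starProjection_apply_mem a
  obtain ⟨s, hsS, hsM⟩ := mem_closure_iff_seq_limit.mp hMK
  have hsc (k : ℕ) : ∃ c : ℕ →₀ ℝ, c.sum (fun i r ↦ r • y i) = s k :=
    Finsupp.mem_span_range_iff_exists_finsupp.mp (hsS k)
  choose c hc using hsc
  have hsY (k : ℕ) : (s k : Ω → ℝ) =ᵐ[P] fun ω ↦ ∑ i ∈ (c k).support, c k i * Y i ω := by
    rw [← hc k]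
    exact coeFn_sum_smul_toLp hY (c k).support (c k)
  obtain ⟨ns, -, hns⟩ := (tendstoInMeasure_of_tendsto_Lp hsM).exists_seq_tendsto_ae
  -- A `limsup` is measurable on all sequences and agrees with the limit wherever the approximants
  -- converge.
  set m : (ℕ → ℝ) → ℝ :=
    fun b ↦ limsup (fun k ↦ ∑ i ∈ (c (ns k)).support, c (ns k) i * b i) atTop with hm
  have hmm : Measurable m := Measurable.limsup fun k ↦ by fun_prop
  have hlim : ∀ᵐ ω ∂P, Tendsto (fun k ↦ ∑ i ∈ (c (ns k)).support, c (ns k) i * Y i ω) atTop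
      (𝓝 (M ω)) := by
    filter_upwards [hns, ae_all_iff.mpr hsY] with ω h1 h2
    exact h1.congr fun k ↦ h2 (ns k)
  have hmM : ∀ᵐ ω ∂P, m (fun i ↦ Y i ω) = M ω := by
    filter_upwards [hlim] with ω hω using hω.limsup_eq
  set N : Ω → ℝ := fun ω ↦ A ω - m (fun i ↦ Y i ω) with hN
  have hNm : AEMeasurable N P :=
    hA.aestronglyMeasurable.aemeasurable.sub (hmm.comp_aemeasurable hBm)
  have hNae : ((a - M : Lp ℝ 2 P) : Ω → ℝ) =ᵐ[P] N := by
    filter_upwards [hmM, Lp.coeFn_sub a M, hA.coeFn_toLp] with ω h1 h2 h3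
    rw [h2, Pi.sub_apply, ha, h3, ← h1]
  have hNL : MemLp N 2 P := (memLp_congr_ae hNae).mp (Lp.memLp (a - M))
  have hNlim : ∀ᵐ ω ∂P, Tendsto
      (fun k ↦ A ω - ∑ i ∈ (c (ns k)).support, c (ns k) i * Y i ω) atTop (𝓝 (N ω)) := by
    filter_upwards [hlim, hmM] with ω h1 h2
    simp only [hN, h2]
    exact h1.const_sub _
  have hres (k : ℕ) := isGaussianProcess_residual hG (c k).support (c k)
  have hres0 (k : ℕ) : ∫ ω, (A ω - ∑ i ∈ (c k).support, c k i * Y i ω) ∂P = 0 := by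
    have hi (i : ℕ) : Integrable (fun ω ↦ c k i * Y i ω) P :=
      ((hY i).integrable one_le_two).const_mul _
    rw [integral_sub (hA.integrable one_le_two) (integrable_finsetSum _ fun i _ ↦ hi i),
      integral_finsetSum _ fun i _ ↦ hi i, hA0]
    simp [integral_const_mul, hY0]
  have hres_law (k : ℕ) :
      HasGaussianLaw (fun ω ↦ A ω - ∑ i ∈ (c k).support, c k i * Y i ω) P :=
    (hres k).hasGaussianLaw_eval (Sum.inl ())
  obtain ⟨v, hv⟩ := exists_map_eq_gaussianReal_of_tendsto_ae
    (fun k ↦ (hres_law (ns k)).aemeasurable)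
    (fun k ↦ by rw [(hres_law (ns k)).map_eq_gaussianReal, hres0]) hNlim
  have hvN : (v : ℝ) = ‖a - M‖ ^ 2 := by
    rw [norm_sq_eq_integral_of_ae_eq hNae]
    have h1 : Var[N; P] = v := by rw [← variance_id_map hNm, hv, variance_id_gaussianReal]
    have h2 : ∫ ω, N ω ∂P = 0 := by
      rw [← integral_map (f := fun x ↦ x) hNm (by fun_prop), hv, integral_id_gaussianReal]
    rw [← h1, variance_of_integral_eq_zero hNm h2]
  -- Joint Gaussianity with the whole past turns the orthogonality of the residual into
  -- independence.
  have hjoint : IsGaussianProcess (Sum.elim Y (fun _ : Unit ↦ N)) P := by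
    have h1 : IsGaussianProcess (Sum.elim (fun _ : Unit ↦ N) Y) P := by
      refine isGaussianProcess_of_tendsto_ae (fun k ↦ hres (ns k)) ?_ ?_
      · rintro k (_ | i)
        · exact hres0 (ns k)
        · exact hY0 i
      · rintro (_ | i)
        · exact hNlim
        · exact ae_of_all _ fun ω ↦ tendsto_const_nhds
    have h2 : Sum.elim Y (fun _ : Unit ↦ N) = Sum.elim (fun _ : Unit ↦ N) Y ∘ Sum.swap := by
      funext x
      cases x <;> rfl
    rw [h2]
    exact h1.comp_right Sum.swap
  have hind : IndepFun (fun ω i ↦ Y i ω) N P := by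
    have h1 := hjoint.indepFun_of_covariance_eq_zero hYm (fun _ ↦ hNm) fun i _ ↦ by
      rw [covariance_eq_sub (hY i) hNL, hY0, zero_mul, sub_zero]
      have h2 : inner ℝ (y i) (a - M) = 0 := by
        refine (Submodule.mem_orthogonal K _).mp (K.sub_starProjection_mem_orthogonal a) _ ?_
        exact S.le_topologicalClosure (Submodule.subset_span ⟨i, rfl⟩)
      rw [← h2, L2.inner_def]
      refine integral_congr_ae ?_
      filter_upwards [hNae, (hY i).coeFn_toLp] with ω h3 h4
      rw [h3, show (y i : Ω → ℝ) ω = Y i ω from h4]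
      simp [mul_comm]
    exact h1.comp measurable_id (measurable_pi_apply ())
  have hpred (p : ℕ) (h : Fin p → ℝ) :
      ∫ ω, (A ω - ∑ i, h i * Y i ω) ^ 2 ∂P = ‖a - ∑ i, h i • y i‖ ^ 2 := by
    refine (norm_sq_eq_integral_of_ae_eq ?_).symm
    filter_upwards [Lp.coeFn_sub a (∑ i, h i • y i), hA.coeFn_toLp,
      coeFn_sum_smul_toLp (fun i : Fin p ↦ hY i) Finset.univ h] with ω h1 h2 h3
    rw [h1, Pi.sub_apply, h2, h3]
  refine ⟨m, N, v, hmm, ?_, hNm, hind, hv, fun p h ↦ ?_, fun ε hε ↦ ?_⟩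
  · ext ω
    simp [hN]
  · rw [hvN, hpred]
    have hmem : ∑ i, h i • y i ∈ K := S.le_topologicalClosure <|
      Submodule.sum_mem _ fun i _ ↦ S.smul_mem _ (Submodule.subset_span ⟨i, rfl⟩)
    have h1 : ‖a - M‖ ≤ ‖a - ∑ i, h i • y i‖ := by
      rw [hM, K.starProjection_minimal]
      exact ciInf_le ⟨0, by rintro _ ⟨x, rfl⟩; positivity⟩ (⟨_, hmem⟩ : K)
    gcongr
  · have h1 : Tendsto (fun k ↦ ‖a - s k‖ ^ 2) atTop (𝓝 (v : ℝ)) := by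
      rw [hvN]
      exact ((hsM.const_sub a).norm).pow 2
    obtain ⟨k, hk⟩ := (h1.eventually (gt_mem_nhds (lt_add_of_pos_right (v : ℝ) hε))).exists
    obtain ⟨p, hp⟩ := (c k).support.exists_nat_subset_range
    refine ⟨p, fun i ↦ c k i, ?_⟩
    rw [hpred, Fin.sum_univ_eq_sum_range (fun i ↦ c k i • y i) p,
      ← Finsupp.sum_of_support_subset (c k) hp (fun i r ↦ r • y i) (by simp), hc k]
    exact hk

/-! ### Dither moments and the splitting of the error. -/

theorem integral_add_half_of_isUniform {Ω : Type*} [MeasurableSpace Ω] {P : Measure Ω}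
    {Z : Ω → ℝ} (hZ : pdf.IsUniform Z (Set.Ioc (-1 : ℝ) 0) P volume) (hZm : AEMeasurable Z P) :
    ∫ ω, (Z ω + 1 / 2) ∂P = 0 := by
  rw [← integral_map (f := fun x ↦ x + 1 / 2) hZm (by fun_prop), hZ, ProbabilityTheory.cond]
  simp only [Real.volume_Ioc, sub_neg_eq_add, zero_add, ENNReal.ofReal_one, inv_one, one_smul]
  rw [← intervalIntegral.integral_of_le (by norm_num)]
  simp [intervalIntegral.integral_add]
  norm_num

theorem integral_add_half_sq_of_isUniform {Ω : Type*} [MeasurableSpace Ω] {P : Measure Ω}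
    {Z : Ω → ℝ} (hZ : pdf.IsUniform Z (Set.Ioc (-1 : ℝ) 0) P volume) (hZm : AEMeasurable Z P) :
    ∫ ω, (Z ω + 1 / 2) ^ 2 ∂P = 1 / 12 := by
  rw [← integral_map (f := fun x ↦ (x + 1 / 2) ^ 2) hZm (by fun_prop), hZ, ProbabilityTheory.cond]
  simp only [Real.volume_Ioc, sub_neg_eq_add, zero_add, ENNReal.ofReal_one, inv_one, one_smul]
  rw [← intervalIntegral.integral_of_le (by norm_num),
    intervalIntegral.integral_comp_add_right (fun x ↦ x ^ 2), integral_pow]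
  norm_num

theorem aemeasurable_of_isUniform {Ω : Type*} [MeasurableSpace Ω] {P : Measure Ω}
    {Z : Ω → ℝ} (hZ : pdf.IsUniform Z (Set.Ioc (-1 : ℝ) 0) P volume) : AEMeasurable Z P :=
  hZ.aemeasurable (by simp) (by simp)

theorem memLp_add_half_of_isUniform {Ω : Type*} [MeasurableSpace Ω] {P : Measure Ω}
    [IsProbabilityMeasure P] {Z : Ω → ℝ} (hZ : pdf.IsUniform Z (Set.Ioc (-1 : ℝ) 0) P volume) :
    MemLp (fun ω ↦ Z ω + 1 / 2) 2 P := by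
  have hZm := aemeasurable_of_isUniform hZ
  -- A non-integrable function has Bochner integral 0, so the value 1/12 already forces
  -- integrability.
  refine (memLp_two_iff_integrable_sq (by fun_prop)).mpr (.of_integral_ne_zero ?_)
  rw [integral_add_half_sq_of_isUniform hZ hZm]
  norm_num

/-- The second moment of a linear combination of independent centered variables. -/
theorem integral_sq_sum_of_iIndepFun {Ω ι : Type*} [MeasurableSpace Ω] {P : Measure Ω}
    [IsProbabilityMeasure P] {W : ι → Ω → ℝ} {σ : ℝ} (hW : ∀ i, MemLp (W i) 2 P)
    (hW0 : ∀ i, ∫ ω, W i ω ∂P = 0) (hW2 : ∀ i, ∫ ω, W i ω ^ 2 ∂P = σ)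
    (hind : iIndepFun W P) (s : Finset ι) (g : ι → ℝ) :
    ∫ ω, (∑ i ∈ s, g i * W i ω) ^ 2 ∂P = σ * ∑ i ∈ s, g i ^ 2 := by
  have hg (i : ι) : MemLp (fun ω ↦ g i * W i ω) 2 P := (hW i).const_mul _
  have hsum : MemLp (∑ i ∈ s, fun ω ↦ g i * W i ω) 2 P := memLp_finsetSum' s fun i _ ↦ hg i
  have h0 : ∫ ω, (∑ i ∈ s, fun ω ↦ g i * W i ω) ω ∂P = 0 := by
    simp only [Finset.sum_apply]
    rw [integral_finsetSum _ fun i _ ↦ (hg i).integrable one_le_two]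
    simp [integral_const_mul, hW0]
  have hvar := IndepFun.variance_sum (s := s) (X := fun i ω ↦ g i * W i ω) (fun i _ ↦ hg i)
    fun i _ j _ hij ↦ (hind.indepFun hij).comp (measurable_const_mul (g i))
      (measurable_const_mul (g j))
  rw [variance_of_integral_eq_zero hsum.aestronglyMeasurable.aemeasurable h0] at hvar
  simp only [Finset.sum_apply] at hvar
  rw [hvar, Finset.mul_sum]
  refine Finset.sum_congr rfl fun i _ ↦ ?_
  rw [variance_const_mul,
    variance_of_integral_eq_zero (hW i).aestronglyMeasurable.aemeasurable (hW0 i), hW2, mul_comm]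

/-- The error of a linear predictor of the unfolded output splits into the prediction error of the
source and the contribution of the dither. -/
theorem integral_sq_sub_linearPredictor {Ω : Type*} [MeasurableSpace Ω] {P : Measure Ω}
    [IsProbabilityMeasure P] {X Z : ℤ → Ω → ℝ} (hX : ∀ n, MemLp (X n) 2 P)
    (hX0 : ∀ n : ℤ, ∫ ω, X n ω ∂P = 0)
    (hZ : ∀ n : ℤ, pdf.IsUniform (Z n) (Set.Ioc (-1 : ℝ) 0) P volume)
    (hZind : iIndepFun Z P)
    (hXZ : IndepFun (fun ω (n : ℤ) ↦ X n ω) (fun ω (n : ℤ) ↦ Z n ω) P)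
    (n : ℤ) (α : ℝ) {p : ℕ} (h : Fin p → ℝ) :
    ∫ ω, (unfoldedOutput α X Z n ω - linearPredictor h (unfoldedOutput α X Z) n ω) ^ 2 ∂P =
      α ^ 2 * ∫ ω, (X n ω - ∑ i : Fin p, h i * X (n - 1 - ((i : ℕ) : ℤ)) ω) ^ 2 ∂P +
        1 / 12 * (1 + ∑ i, h i ^ 2) := by
  set W : ℤ → Ω → ℝ := fun k ω ↦ Z k ω + 1 / 2 with hW
  have hWL (k : ℤ) : MemLp (W k) 2 P := memLp_add_half_of_isUniform (hZ k)
  have hW0 (k : ℤ) : ∫ ω, W k ω ∂P = 0 :=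
    integral_add_half_of_isUniform (hZ k) (aemeasurable_of_isUniform (hZ k))
  have hW2 (k : ℤ) : ∫ ω, W k ω ^ 2 ∂P = 1 / 12 :=
    integral_add_half_sq_of_isUniform (hZ k) (aemeasurable_of_isUniform (hZ k))
  have hWind : iIndepFun W P :=
    hZind.comp (fun _ x ↦ x + 1 / 2) fun _ ↦ by fun_prop
  let f : (ℤ → ℝ) → ℝ := fun x ↦ x n - ∑ i : Fin p, h i * x (n - 1 - ((i : ℕ) : ℤ))
  let g : (ℤ → ℝ) → ℝ := fun z ↦ f fun k ↦ z k + 1 / 2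
  have hf : Measurable f := by fun_prop
  have hg : Measurable g := by fun_prop
  set U : Ω → ℝ := fun ω ↦ X n ω - ∑ i : Fin p, h i * X (n - 1 - ((i : ℕ) : ℤ)) ω with hU
  set T : Ω → ℝ := fun ω ↦ W n ω - ∑ i : Fin p, h i * W (n - 1 - ((i : ℕ) : ℤ)) ω with hT
  have hUL : MemLp U 2 P := (hX n).sub (memLp_finsetSum _ fun i _ ↦ (hX _).const_mul _)
  have hTL : MemLp T 2 P := (hWL n).sub (memLp_finsetSum _ fun i _ ↦ (hWL _).const_mul _)
  have hUT : IndepFun U T P := hXZ.comp hf hg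
  have hU0 : ∫ ω, U ω ∂P = 0 := by
    have hi (i : Fin p) : Integrable (fun ω ↦ h i * X (n - 1 - ((i : ℕ) : ℤ)) ω) P :=
      ((hX _).integrable one_le_two).const_mul _
    rw [hU, integral_sub ((hX n).integrable one_le_two) (integrable_finsetSum _ fun i _ ↦ hi i),
      integral_finsetSum _ fun i _ ↦ hi i, hX0]
    simp [integral_const_mul, hX0]
  have hT2 : ∫ ω, T ω ^ 2 ∂P = 1 / 12 * (1 + ∑ i, h i ^ 2) := by
    -- `T` combines the dithers at times n, n-1, …, n-p with coefficients 1, -h₁, …, -h_p.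
    let e : Fin (p + 1) → ℤ := fun j ↦ n - ((j : ℕ) : ℤ)
    have he : Function.Injective e := fun i j hij ↦ by
      simp only [e] at hij
      omega
    have h1 := integral_sq_sum_of_iIndepFun (fun j ↦ hWL (e j)) (fun j ↦ hW0 (e j))
      (fun j ↦ hW2 (e j)) (hWind.precomp he) Finset.univ (Fin.cons 1 fun i ↦ -h i)
    simp only [Fin.sum_univ_succ, Fin.cons_zero, Fin.cons_succ, one_pow, neg_sq] at h1
    rw [← h1]
    refine integral_congr_ae (ae_of_all _ fun ω ↦ ?_)
    have h2 (i : Fin p) : e i.succ = n - 1 - ((i : ℕ) : ℤ) := by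
      simp only [e, Fin.val_succ]
      push_cast
      ring
    simp only [hT, h2]
    simp [e, sub_eq_add_neg]
  -- The shifts by 1/2 in the predictor exactly center the dither: the error is αU + T.
  have hsplit (ω : Ω) :
      (unfoldedOutput α X Z n ω - linearPredictor h (unfoldedOutput α X Z) n ω) ^ 2 =
        α ^ 2 * U ω ^ 2 + 2 * α * (U ω * T ω) + T ω ^ 2 := by
    have h1 : linearPredictor h (unfoldedOutput α X Z) n ω =
        α * (∑ i : Fin p, h i * X (n - 1 - ((i : ℕ) : ℤ)) ω) +
          (∑ i : Fin p, h i * W (n - 1 - ((i : ℕ) : ℤ)) ω) - 1 / 2 := by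
      simp only [linearPredictor, unfoldedOutput, hW, Finset.mul_sum, ← Finset.sum_add_distrib]
      congr 1
      refine Finset.sum_congr rfl fun i _ ↦ ?_
      rw [show n - (((i : ℕ) : ℤ) + 1) = n - 1 - ((i : ℕ) : ℤ) by ring]
      ring
    rw [h1]
    simp only [unfoldedOutput, hU, hT, hW]
    ring
  have hUTi : Integrable (fun ω ↦ U ω * T ω) P := hUL.integrable_mul hTL
  have hUT0 : ∫ ω, U ω * T ω ∂P = 0 := by
    have := hUT.integral_mul_eq_mul_integral hUL.aestronglyMeasurable hTL.aestronglyMeasurable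
    rw [hU0, zero_mul] at this
    exact this
  simp only [hsplit]
  have h1 : Integrable (fun ω ↦ α ^ 2 * U ω ^ 2) P := hUL.integrable_sq.const_mul _
  have h2 : Integrable (fun ω ↦ 2 * α * (U ω * T ω)) P := hUTi.const_mul _
  have h12 : Integrable (fun ω ↦ α ^ 2 * U ω ^ 2 + 2 * α * (U ω * T ω)) P := h1.add h2
  rw [integral_add h12 hTL.integrable_sq, integral_add h1 h2, integral_const_mul,
    integral_const_mul, hUT0, hT2]
  ring

/-! ### Penalized least squares: many taps, then vanishing penalty. -/

theorem bddBelow_range_regularized {p : ℕ} {q : (Fin p → ℝ) → ℝ} (hq : ∀ h, 0 ≤ q h) {D : ℝ}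
    (hD : 0 < D) : BddBelow (Set.range fun h ↦ q h / D + (1 + ∑ i, h i ^ 2)) := by
  refine ⟨0, ?_⟩
  rintro _ ⟨h, rfl⟩
  have := hq h
  positivity

theorem one_le_iInf_regularized {p : ℕ} {q : (Fin p → ℝ) → ℝ} (hq : ∀ h, 0 ≤ q h) {D : ℝ}
    (hD : 0 < D) : 1 ≤ ⨅ h, (q h / D + (1 + ∑ i, h i ^ 2)) := by
  refine le_ciInf fun h ↦ ?_
  have h1 : 0 ≤ q h / D := div_nonneg (hq h) hD.le
  have h2 : 0 ≤ ∑ i, h i ^ 2 := by positivity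
  linarith

/-- As the weight of the penalty on the taps vanishes, the regularized least error tends to the
infimum of the unregularized errors. -/
theorem tendsto_mul_iInf_regularized {q : (p : ℕ) → (Fin p → ℝ) → ℝ} {v : ℝ} (hv : 0 ≤ v)
    (hlow : ∀ p h, v ≤ q p h) (happrox : ∀ ε > 0, ∃ p h, q p h < v + ε) :
    Tendsto (fun D : ℝ ↦ D * ⨅ p, ⨅ h, (q p h / D + (1 + ∑ i, h i ^ 2))) (𝓝[>] 0) (𝓝 v) := by
  have hq (p : ℕ) (h : Fin p → ℝ) : 0 ≤ q p h := hv.trans (hlow p h)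
  refine tendsto_order.mpr ⟨fun a ha ↦ ?_, fun b hb ↦ ?_⟩
  · filter_upwards [self_mem_nhdsWithin] with D (hD : 0 < D)
    have h1 : v / D ≤ ⨅ p, ⨅ h, (q p h / D + (1 + ∑ i, h i ^ 2)) := by
      refine le_ciInf fun p ↦ le_ciInf fun h ↦ ?_
      have h2 : v / D ≤ q p h / D := by gcongr; exact hlow p h
      have h3 : 0 ≤ ∑ i, h i ^ 2 := by positivity
      linarith
    rw [div_le_iff₀' hD] at h1
    exact ha.trans_le h1
  -- These taps have error below `b` and stay fixed as D → 0, so their penalty vanishes.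
  · obtain ⟨p, h, hph⟩ := happrox (b - v) (by linarith)
    have hlim : Tendsto (fun D : ℝ ↦ q p h + D * (1 + ∑ i, h i ^ 2)) (𝓝[>] 0) (𝓝 (q p h)) := by
      have hc : Continuous fun D : ℝ ↦ q p h + D * (1 + ∑ i, h i ^ 2) := by fun_prop
      simpa using (hc.tendsto 0).mono_left nhdsWithin_le_nhds
    filter_upwards [self_mem_nhdsWithin, hlim.eventually (gt_mem_nhds (show q p h < b by linarith))]
      with D (hD : 0 < D) hlt
    refine lt_of_le_of_lt ?_ hlt
    have h1 : ⨅ p, ⨅ h, (q p h / D + (1 + ∑ i, h i ^ 2)) ≤ q p h / D + (1 + ∑ i, h i ^ 2) := by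
      refine (ciInf_le ⟨1, ?_⟩ p).trans (ciInf_le (bddBelow_range_regularized (hq p) hD) h)
      rintro _ ⟨r, rfl⟩
      exact one_le_iInf_regularized (hq r) hD
    calc D * ⨅ p, ⨅ h, (q p h / D + (1 + ∑ i, h i ^ 2))
        ≤ D * (q p h / D + (1 + ∑ i, h i ^ 2)) := by gcongr
      _ = q p h + D * (1 + ∑ i, h i ^ 2) := by field_simp

/-- The regularized least errors decrease to their infimum as the number of taps grows. -/
theorem tendsto_iInf_regularized {q : (p : ℕ) → (Fin p → ℝ) → ℝ} (hq : ∀ p h, 0 ≤ q p h)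
    (hsnoc : ∀ p h, q (p + 1) (Fin.snoc h 0) = q p h) {D : ℝ} (hD : 0 < D) :
    Tendsto (fun p ↦ ⨅ h, (q p h / D + (1 + ∑ i, h i ^ 2))) atTop
      (𝓝 (⨅ p, ⨅ h, (q p h / D + (1 + ∑ i, h i ^ 2)))) := by
  refine tendsto_atTop_ciInf (antitone_nat_of_succ_le fun p ↦ le_ciInf fun h ↦ ?_) ⟨1, ?_⟩
  -- An extra zero tap changes neither the error nor the penalty.
  · refine ciInf_le_of_le (bddBelow_range_regularized (hq (p + 1)) hD) (Fin.snoc h 0) ?_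
    rw [hsnoc, Fin.sum_univ_castSucc]
    simp
  · rintro _ ⟨r, rfl⟩
    exact one_le_iInf_regularized (hq r) hD

/-! ### Assembly. -/

theorem resolution_sq {D : ℝ} (hD : 0 < D) : resolution D ^ 2 = 1 / (12 * D) := by
  rw [resolution, div_pow, Real.sq_sqrt (by positivity), one_pow]

theorem proposition2 {Ω : Type*} [MeasurableSpace Ω] (P : Measure Ω) [IsProbabilityMeasure P]
    (X Z : ℤ → Ω → ℝ)
    (hX_gaussian : IsGaussianProcess X P)
    (hX_mean : ∀ n : ℤ, ∫ ω, X n ω ∂P = 0)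
    (hX_stationary : IsStationaryProcess X P)
    (hZ_uniform : ∀ n : ℤ, pdf.IsUniform (Z n) (Set.Ioc (-1 : ℝ) 0) P volume)
    (hZ_indep : iIndepFun Z P)
    (hXZ_indep : IndepFun (fun ω (n : ℤ) ↦ X n ω) (fun ω (n : ℤ) ↦ Z n ω) P)
    (n : ℤ)
    (h_entropy : ⊥ < entropyRate X P n) :
    ∃ L : ℝ → ℝ,
      (∀ D : ℝ, 0 < D →
        Tendsto
          (fun p : ℕ ↦ 1 / 2 * Real.logb 2
            (12 * predictionErrorVariance (unfoldedOutput (resolution D) X Z) P n p))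
          atTop (𝓝 (L D))) ∧
      Tendsto (fun D : ℝ ↦ (L D : EReal) - shannonLowerBound X P n D) (𝓝[>] 0) (𝓝 0) := by
  have hXL (k : ℤ) : MemLp (X k) 2 P := (hX_gaussian.hasGaussianLaw_eval k).memLp_two
  set Y : ℕ → Ω → ℝ := fun i ↦ X (n - 1 - (i : ℤ)) with hY
  have hG : IsGaussianProcess (Sum.elim (fun _ : Unit ↦ X n) Y) P := by
    have h1 : Sum.elim (fun _ : Unit ↦ X n) Y =
        X ∘ Sum.elim (fun _ : Unit ↦ n) (fun i : ℕ ↦ n - 1 - (i : ℤ)) := by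
      funext x
      cases x <;> rfl
    rw [h1]
    exact hX_gaussian.comp_right _
  obtain ⟨m, N, v, hm, hdecomp, hN, hind, hlaw, hlow, happrox⟩ :=
    exists_innovation_decomposition hG (hX_mean n) fun i ↦ hX_mean _
  have hpast : AEMeasurable (fun ω i ↦ Y i ω) P :=
    aemeasurable_pi_lambda _ fun i ↦ hX_gaussian.aemeasurable (n - 1 - (i : ℤ))
  have hrate := condDifferentialEntropy_eq hpast hN hm hdecomp hind hlaw
  change entropyRate X P n = _ at hrate
  have hv : v ≠ 0 := by
    rintro rfl
    simp [hrate] at h_entropy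
  rw [if_neg hv] at hrate
  have hv0 : (0 : ℝ) < v := by positivity
  set q : (p : ℕ) → (Fin p → ℝ) → ℝ :=
    fun p h ↦ ∫ ω, (X n ω - ∑ i, h i * Y i ω) ^ 2 ∂P with hq
  have hq0 (p : ℕ) (h : Fin p → ℝ) : 0 ≤ q p h := hv0.le.trans (hlow p h)
  have hsnoc (p : ℕ) (h : Fin p → ℝ) : q (p + 1) (Fin.snoc h 0) = q p h := by
    simp [hq, Fin.sum_univ_castSucc]
  have hpev {D : ℝ} (hD : 0 < D) (p : ℕ) :
      12 * predictionErrorVariance (unfoldedOutput (resolution D) X Z) P n p =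
        ⨅ h, (q p h / D + (1 + ∑ i, h i ^ 2)) := by
    rw [predictionErrorVariance, Real.mul_iInf_of_nonneg (by norm_num)]
    congr 1
    funext h
    rw [integral_sq_sub_linearPredictor hXL hX_mean hZ_uniform hZ_indep hXZ_indep,
      resolution_sq hD]
    simp only [hq, hY]
    field_simp
  set S : ℝ → ℝ := fun D ↦ ⨅ p, ⨅ h, (q p h / D + (1 + ∑ i, h i ^ 2)) with hS
  have hS1 {D : ℝ} (hD : 0 < D) : 0 < S D :=
    zero_lt_one.trans_le (le_ciInf fun p ↦ one_le_iInf_regularized (hq0 p) hD)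
  refine ⟨fun D ↦ 1 / 2 * Real.logb 2 (S D), fun D hD ↦ ?_, ?_⟩
  · simp only [hpev hD]
    exact (((tendsto_iInf_regularized hq0 hsnoc hD).log (hS1 hD).ne').div_const _).const_mul _
  -- For D > 0 this function is exactly the gap to the Shannon bound, as the 2πe terms cancel.
  · have hlim : Tendsto (fun D ↦ 1 / 2 * (Real.log (D * S D) / Real.log 2) -
        1 / 2 * (Real.log v / Real.log 2)) (𝓝[>] 0) (𝓝 0) := by
      have h1 := ((((tendsto_mul_iInf_regularized hv0.le hlow happrox).log hv0.ne').div_const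
        (Real.log 2)).const_mul (1 / 2)).sub_const (1 / 2 * (Real.log v / Real.log 2))
      rwa [sub_self] at h1
    have hlim' := (continuous_coe_real_ereal.tendsto 0).comp hlim
    rw [EReal.coe_zero] at hlim'
    refine hlim'.congr' ?_
    filter_upwards [self_mem_nhdsWithin] with D (hD : 0 < D)
    rw [shannonLowerBound, hrate, ← EReal.coe_sub, ← EReal.coe_sub, Function.comp_apply]
    congr 1
    simp only [Real.logb]
    rw [Real.log_mul (x := D) hD.ne' (hS1 hD).ne',
      Real.log_mul (y := (v : ℝ)) (by positivity) hv0.ne',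
      Real.log_mul (y := D) (by positivity) hD.ne']
    ring
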